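/- Let $\mathcal X$ be a measurable space and let $p_t(x,dy)$, $t\ge 0$, be time-homogeneous Markov transition probabilities on $\mathcal X$ (Markov kernels with $p_0(x,\cdot)=\delta_x$ and $p_{s+t}(x,B)=\int p_t(y,B)\,p_s(x,dy)$), with an invariant probability measure $\mu^*$. Write $\mathcal P_t[g](x)=\int g(y)\,p_t(x,dy)$ and $\mathcal P_t^*[\nu](B)=\int p_t(x,B)\,\nu(dx)$, and let $(A,D(A))$ be the generator of $(\mathcal P_t)_{t\ge0}$ on the complex space $L^2(\mu^*)$: $D(A)$ is the set of $g\in L^2(\mu^*)$ for which $A[g]=\lim_{t\downarrow 0}(\mathcal P_t[g]-g)/t$ exists in $L^2(\mu^*)$. Let $D(A,\mathbb R)$ be the set of real-valued functions in $D(A)$. Suppose that $(A,D(A))$ is self-adjoint and that $W:\mathcal X\to[1,\infty)$ is measurable. For measurable $\phi:\mathcal X\to\mathbb R$ and finite signed measures $\pi$ on $\mathcal X$ define $$|\phi|_W=\sup_{x\in\mathcal X}\frac{|\phi(x)|}{W(x)},\qquad |\pi|_W=\int W\,d|\pi| .$$ Let $\lambda\ge0$ and $\rho\ge0$, at least one of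 them nonzero. Suppose that for every bounded measurable $h:\mathcal X\to[0,\infty)$ with $\int h\,d\mu^*=1$ there are times $t_n^h\ge0$ with $t_n^h\to\infty$ as $n\to\infty$ and constants $C_h,D_h\in[0,\infty)$ such that, with $d\nu=h\,d\mu^*$, for all $n$, $$|\mathcal P_{t_n^h}[h]-1|_W\le D_h e^{-\rho t_n^h}\qquad\text{and}\qquad |\mathcal P^*_{t_n^h}[\nu]-\mu^*|_W\le C_h e^{-\lambda t_n^h}.$$ Then $A$ satisfies the Poincaré inequality $$\operatorname{Var}_{\mu^*}(g)\le-\frac{2}{\lambda+\rho}\,\langle A[g],g\rangle\qquad\text{for all } g\in D(A,\mathbb R).$$ -/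

import Mathlib

open MeasureTheory ProbabilityTheory Filter Topology
open scoped NNReal ENNReal

namespace MarkovPoincare

noncomputable section

/-- `p t` (for `t ≥ 0`) are the time-homogeneous transition probabilities of a Markov process:
the process starts at its initial point and the Chapman-Kolmogorov equations hold. -/
structure IsTransitionSemigroup {X : Type*} [MeasurableSpace X] (p : ℝ≥0 → Kernel X X) :
    Prop where
  zero : p 0 = Kernel.id
  add : ∀ s t : ℝ≥0, p (s + t) = p t ∘ₖ p s

section L2Operator

variable {X : Type*} [MeasurableSpace X] {μ : Measure X} {κ : Kernel X X}

lemma ae_ae_of_invariant (hκ : κ.Invariant μ) {q : X → Prop} (hq : ∀ᵐ y ∂μ, q y) :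
    ∀ᵐ x ∂μ, ∀ᵐ y ∂(κ x), q y := by
  apply Measure.ae_ae_of_ae_comp
  rw [hκ.def]
  exact hq

lemma lintegral_average (hκ : κ.Invariant μ) {f : X → ℝ≥0∞} (hf : Measurable f) :
    ∫⁻ x, ∫⁻ y, f y ∂(κ x) ∂μ = ∫⁻ y, f y ∂μ := by
  conv_rhs => rw [← hκ.def]
  rw [Measure.lintegral_bind κ.aemeasurable hf.aemeasurable]

lemma eLpNorm_average_le [IsMarkovKernel κ] (hκ : κ.Invariant μ) {f : X → ℂ}
    (hf : StronglyMeasurable f) :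
    eLpNorm (fun x => ∫ y, f y ∂(κ x)) 2 μ ≤ eLpNorm f 2 μ := by
  have key : ∀ x, ‖∫ y, f y ∂(κ x)‖ₑ ^ (2 : ℝ) ≤ ∫⁻ y, ‖f y‖ₑ ^ (2 : ℝ) ∂(κ x) := by
    intro x
    have h1 : ‖∫ y, f y ∂(κ x)‖ₑ ≤ eLpNorm f 2 (κ x) := by
      refine (enorm_integral_le_lintegral_enorm f).trans ?_
      rw [← eLpNorm_one_eq_lintegral_enorm]
      exact eLpNorm_le_eLpNorm_of_exponent_le (by norm_num) hf.aestronglyMeasurable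
    rw [eLpNorm_eq_lintegral_rpow_enorm_toReal (by norm_num) (by norm_num)] at h1
    have h2 := ENNReal.rpow_le_rpow h1 (z := 2) (by norm_num)
    rw [← ENNReal.rpow_mul] at h2
    simpa using h2
  rw [eLpNorm_eq_lintegral_rpow_enorm_toReal (by norm_num) (by norm_num),
    eLpNorm_eq_lintegral_rpow_enorm_toReal (by norm_num) (by norm_num)]
  refine ENNReal.rpow_le_rpow ?_ (by positivity)
  have h3 : ∫⁻ x, ∫⁻ y, ‖f y‖ₑ ^ (2 : ℝ) ∂(κ x) ∂μ = ∫⁻ y, ‖f y‖ₑ ^ (2 : ℝ) ∂μ :=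
    lintegral_average hκ (hf.measurable.enorm.pow_const _)
  simpa using (lintegral_mono key).trans h3.le

lemma memLp_average [IsMarkovKernel κ] (hκ : κ.Invariant μ) (f : Lp ℂ 2 μ) :
    MemLp (fun x => ∫ y, f y ∂(κ x)) 2 μ :=
  ⟨((Lp.stronglyMeasurable f).integral_kernel (κ := κ)).aestronglyMeasurable,
    (eLpNorm_average_le hκ (Lp.stronglyMeasurable f)).trans_lt (Lp.memLp f).2⟩

lemma ae_integrable [IsMarkovKernel κ] [IsFiniteMeasure μ] (hκ : κ.Invariant μ)
    (f : Lp ℂ 2 μ) : ∀ᵐ x ∂μ, Integrable f (κ x) := by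
  have hm : Measurable fun y => ‖f y‖ₑ := (Lp.stronglyMeasurable f).measurable.enorm
  have h1 : ∫⁻ y, ‖f y‖ₑ ∂μ < ∞ :=
    ((Lp.memLp f).integrable (by norm_num)).hasFiniteIntegral
  have h2 : ∫⁻ x, ∫⁻ y, ‖f y‖ₑ ∂(κ x) ∂μ = ∫⁻ y, ‖f y‖ₑ ∂μ := lintegral_average hκ hm
  filter_upwards [ae_lt_top hm.lintegral_kernel (h2.trans_lt h1).ne] with x hx
  exact ⟨(Lp.stronglyMeasurable f).aestronglyMeasurable, hx⟩

/-- The Markov operator `f ↦ (x ↦ ∫ f(y) κ(x, dy))` on the complex Hilbert space `L²(μ)`, for a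
Markov kernel `κ` with invariant probability measure `μ`. -/
def l2Operator [IsMarkovKernel κ] [IsFiniteMeasure μ] (hκ : κ.Invariant μ) :
    Lp ℂ 2 μ →L[ℂ] Lp ℂ 2 μ :=
  LinearMap.mkContinuous
    { toFun := fun f => (memLp_average hκ f).toLp _
      map_add' := by
        intro f g
        rw [← MemLp.toLp_add, MemLp.toLp_eq_toLp_iff]
        filter_upwards [ae_ae_of_invariant hκ (Lp.coeFn_add f g), ae_integrable hκ f,
          ae_integrable hκ g] with x hx hf hg
        rw [integral_congr_ae hx]
        exact integral_add hf hg
      map_smul' := by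
        intro c f
        rw [RingHom.id_apply, ← MemLp.toLp_const_smul, MemLp.toLp_eq_toLp_iff]
        filter_upwards [ae_ae_of_invariant hκ (Lp.coeFn_smul c f)] with x hx
        rw [integral_congr_ae hx]
        exact integral_smul c f }
    1 (by
      intro f
      rw [one_mul]
      change ‖(memLp_average hκ f).toLp _‖ ≤ ‖f‖
      rw [Lp.norm_toLp, Lp.norm_def]
      exact ENNReal.toReal_mono (Lp.memLp f).2.ne
        (eLpNorm_average_le hκ (Lp.stronglyMeasurable f)))

end L2Operator

section Generator

variable {H : Type*} [NormedAddCommGroup H] [NormedSpace ℂ H]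

/-- `g` is the derivative at time zero (from the right) of `t ↦ T t f`. -/
def HasGeneratorAt (T : ℝ≥0 → H →L[ℂ] H) (f g : H) : Prop :=
  Tendsto (fun t : ℝ≥0 => ((t : ℝ) : ℂ)⁻¹ • (T t f - f)) (𝓝[>] 0) (𝓝 g)

lemma HasGeneratorAt.add {T : ℝ≥0 → H →L[ℂ] H} {f f' g g' : H} (h : HasGeneratorAt T f g)
    (h' : HasGeneratorAt T f' g') : HasGeneratorAt T (f + f') (g + g') := by
  refine (Tendsto.add h h').congr fun t => ?_
  rw [map_add, ← smul_add]
  congr 1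
  abel

lemma HasGeneratorAt.smul {T : ℝ≥0 → H →L[ℂ] H} {f g : H} (c : ℂ) (h : HasGeneratorAt T f g) :
    HasGeneratorAt T (c • f) (c • g) := by
  refine (Tendsto.const_smul h c).congr fun t => ?_
  rw [map_smul, ← smul_sub, smul_comm]

lemma HasGeneratorAt.unique {T : ℝ≥0 → H →L[ℂ] H} {f g g' : H} (h : HasGeneratorAt T f g)
    (h' : HasGeneratorAt T f g') : g = g' :=
  tendsto_nhds_unique h h'

/-- The infinitesimal generator `(A, D(A))` of a one-parameter family of operators: `D(A)` is the
set of all `f` for which `(T t f - f) / t` converges in norm as `t ↓ 0`, and `A f` is the limit. -/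
def generator (T : ℝ≥0 → H →L[ℂ] H) : H →ₗ.[ℂ] H where
  domain :=
    { carrier := {f | ∃ g, HasGeneratorAt T f g}
      add_mem' := by
        rintro f f' ⟨g, hg⟩ ⟨g', hg'⟩
        exact ⟨g + g', hg.add hg'⟩
      zero_mem' := ⟨0, by simp [HasGeneratorAt]⟩
      smul_mem' := by
        rintro c f ⟨g, hg⟩
        exact ⟨c • g, hg.smul c⟩ }
  toFun :=
    { toFun := fun f => f.2.choose
      map_add' := fun f f' =>
        (f + f').2.choose_spec.unique (f.2.choose_spec.add f'.2.choose_spec)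
      map_smul' := fun c f => (c • f).2.choose_spec.unique (f.2.choose_spec.smul c) }

end Generator

variable {X : Type*} [MeasurableSpace X]

/-- The Markov semigroup `𝒫_t` on `L²(μ)` determined by transition probabilities `p t` with
invariant probability measure `μ`. -/
def l2Semigroup (p : ℝ≥0 → Kernel X X) [∀ t, IsMarkovKernel (p t)] {μ : Measure X}
    [IsFiniteMeasure μ] (hμ : ∀ t, (p t).Invariant μ) : ℝ≥0 → Lp ℂ 2 μ →L[ℂ] Lp ℂ 2 μ :=
  fun t => l2Operator (hμ t)

/-- The pointwise action `𝒫[h](x) = ∫ h(y) κ(x, dy)` of a kernel on real functions. -/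
def average (κ : Kernel X X) (h : X → ℝ) (x : X) : ℝ :=
  ∫ y, h y ∂(κ x)

/-- The Poincaré inequality with constant `α`: `Var_μ(g) ≤ -α ⟨A g, g⟩` for all real-valued
functions `g` in the domain of `A`. -/
def PoincareInequality {μ : Measure X} (A : Lp ℂ 2 μ →ₗ.[ℂ] Lp ℂ 2 μ) (α : ℝ) : Prop :=
  ∀ g : A.domain, (∀ᵐ x ∂μ, ((g : Lp ℂ 2 μ) x).im = 0) →
    variance (fun x => ((g : Lp ℂ 2 μ) x).re) μ ≤ -α * (inner ℂ (A g) (g : Lp ℂ 2 μ)).re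

/-- `|φ|_W = sup_x |φ(x)| / W(x)`, with values in `[0, ∞]`. -/
def weightedSupNorm (W φ : X → ℝ) : ℝ≥0∞ :=
  ⨆ x, ENNReal.ofReal (|φ x| / W x)

/-- `|π|_W = ∫ W d|π|`, with values in `[0, ∞]`, for a signed measure `π`. -/
def weightedTV (W : X → ℝ) (π : SignedMeasure X) : ℝ≥0∞ :=
  ∫⁻ x, ENNReal.ofReal (W x) ∂π.totalVariation

/-- A bounded measurable function `h : X → [0, ∞)` with `∫ h dμ = 1`. -/
structure BoundedDensity (μ : Measure X) where
  toFun : X → ℝ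
  measurable : Measurable toFun
  nonneg : ∀ x, 0 ≤ toFun x
  bounded : ∃ M : ℝ, ∀ x, toFun x ≤ M
  integral_eq_one : ∫ x, toFun x ∂μ = 1

/-- The measure `dν = h dμ`. -/
def BoundedDensity.measure {μ : Measure X} (h : BoundedDensity μ) : Measure X :=
  μ.withDensity fun x => ENNReal.ofReal (h.toFun x)

instance BoundedDensity.isProbabilityMeasure {μ : Measure X} (h : BoundedDensity μ) :
    IsProbabilityMeasure h.measure := by
  constructor
  have hi : Integrable h.toFun μ := by
    by_contra hn
    have := h.integral_eq_one
    rw [integral_undef hn] at this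
    exact zero_ne_one this
  rw [BoundedDensity.measure, withDensity_apply _ MeasurableSet.univ, Measure.restrict_univ,
    ← ofReal_integral_eq_lintegral_ofReal hi (Eventually.of_forall h.nonneg), h.integral_eq_one,
    ENNReal.ofReal_one]

end

end MarkovPoincare

namespace MarkovPoincare

/-! ### Contraction semigroups with a densely defined generator -/

section AbstractSemigroup

/-! Put `α = (lam + rho) / 2`. Self-adjointness of the generator makes every operator `𝒫_t`
symmetric: `s ↦ ⟨𝒫_s f, 𝒫_{t-s} g⟩` has zero right derivative on the domain, which is dense
(`inner_apply_comm`). For a bounded density `h` with `dν = h dμ`, symmetry turns `‖𝒫_t h - 1‖²` into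
the integral of `𝒫_t h - 1` against `𝒫_t^* ν - μ`. This is at most the product of the two weighted
distances (`norm_l2Operator_sub_sq_le`), hence `O(e^{-2αt})` along the given times.

By symmetry and Cauchy-Schwarz, norms along an orbit are log-convex, so decay at rate `α` along
times tending to infinity, with any constant, forces `‖𝒫_t f‖ ≤ e^{-αt} ‖f‖` for all `t`
(`norm_apply_le_exp`). The constants `C`, `D`, which depend on `h`, have thus disappeared. The bound
therefore passes by scaling to bounded centered functions and by density to all real centered
functions in `L²`. Comparing difference quotients at `t = 0` gives the Poincaré inequality
(`HasGeneratorAt.norm_sq_le`). -/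

lemma tendsto_toNNReal_sub (s : ℝ) :
    Tendsto (fun y : ℝ => (y - s).toNNReal) (𝓝[>] s) (𝓝[>] 0) := by
  refine tendsto_nhdsWithin_iff.2 ⟨?_, ?_⟩
  · have : Continuous fun y : ℝ => (y - s).toNNReal := by fun_prop
    simpa using (this.tendsto s).mono_left nhdsWithin_le_nhds
  · filter_upwards [self_mem_nhdsWithin] with y hy
    simpa using hy

/-- A semigroup of linear contractions of a normed space. -/
structure IsContractionSemigroup {H : Type*} [NormedAddCommGroup H] [NormedSpace ℂ H]
    (T : ℝ≥0 → H →L[ℂ] H) : Prop where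
  zero : ∀ f, T 0 f = f
  add : ∀ s t f, T (s + t) f = T s (T t f)
  norm_le : ∀ t f, ‖T t f‖ ≤ ‖f‖

variable {H : Type*} [NormedAddCommGroup H]

section Normed

variable [NormedSpace ℂ H] {T : ℝ≥0 → H →L[ℂ] H}

lemma hasGeneratorAt_generator (f : (generator T).domain) :
    HasGeneratorAt T f (generator T f) :=
  f.2.choose_spec

lemma HasGeneratorAt.generator_eq {f g : H} (h : HasGeneratorAt T f g) :
    generator T ⟨f, g, h⟩ = g :=
  (hasGeneratorAt_generator ⟨f, g, h⟩).unique h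

lemma HasGeneratorAt.tendsto_nhdsGT {f g : H} (h : HasGeneratorAt T f g) :
    Tendsto (fun t => T t f) (𝓝[>] 0) (𝓝 f) := by
  have h1 : Tendsto (fun t : ℝ≥0 => ((t : ℝ) : ℂ)) (𝓝[>] 0) (𝓝 0) := by
    have : Continuous fun t : ℝ≥0 => ((t : ℝ) : ℂ) := by fun_prop
    simpa using (this.tendsto 0).mono_left nhdsWithin_le_nhds
  have h2 := (h1.smul h).add_const f
  rw [zero_smul, zero_add] at h2
  refine h2.congr' ?_
  filter_upwards [self_mem_nhdsWithin] with t ht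
  have : ((t : ℝ) : ℂ) ≠ 0 := by
    have h0 : (0 : ℝ≥0) < t := ht
    simpa using h0.ne'
  rw [smul_inv_smul₀ this, sub_add_cancel]

namespace IsContractionSemigroup

variable (hT : IsContractionSemigroup T)
include hT

lemma comm (s t : ℝ≥0) (f : H) : T s (T t f) = T t (T s f) := by
  rw [← hT.add, ← hT.add, add_comm]

lemma norm_antitone (f : H) : Antitone fun t => ‖T t f‖ := by
  intro s t hst
  obtain ⟨r, rfl⟩ := exists_add_of_le hst
  simp only [add_comm s r, hT.add]
  exact hT.norm_le _ _

/-- Strong continuity is not assumed. On the domain it follows from convergent difference quotients,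
and the uniform contraction bound carries it to the closure. -/
lemma tendsto_zero_of_dense (hd : Dense ((generator T).domain : Set H)) (f : H) :
    Tendsto (fun t => T t f) (𝓝 0) (𝓝 f) := by
  have key : ∀ f ∈ (generator T).domain, Tendsto (fun t => T t f) (𝓝 0) (𝓝 f) := by
    rintro f ⟨g, hg⟩
    have hu : insert 0 (Set.Ioi (0 : ℝ≥0)) = Set.univ := by
      rw [Set.Ioi_insert, ← bot_eq_zero, Set.Ici_bot]
    rw [← nhdsWithin_univ, ← hu, nhdsWithin_insert, tendsto_sup]
    refine ⟨?_, hg.tendsto_nhdsGT⟩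
    rw [tendsto_pure_left]
    intro s hs
    rw [hT.zero]
    exact mem_of_mem_nhds hs
  rw [Metric.tendsto_nhds]
  intro ε hε
  obtain ⟨f', hf', hd'⟩ := hd.exists_dist_lt f (show 0 < ε / 3 by positivity)
  filter_upwards [Metric.tendsto_nhds.1 (key f' hf') (ε / 3) (by positivity)] with t ht
  have h1 : dist (T t f) (T t f') ≤ dist f f' := by
    rw [dist_eq_norm, dist_eq_norm, ← map_sub]
    exact hT.norm_le _ _
  have h2 := dist_triangle4 (T t f) (T t f') f' f
  rw [dist_comm f' f] at h2
  linarith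

lemma norm_sub_le (s t : ℝ≥0) (f : H) : ‖T s f - T t f‖ ≤ ‖T (nndist s t) f - f‖ := by
  wlog hst : s ≤ t generalizing s t
  · rw [norm_sub_rev, nndist_comm]
    exact this t s (le_of_not_ge hst)
  obtain ⟨r, rfl⟩ := exists_add_of_le hst
  have : nndist s (s + r) = r := by
    ext
    rw [coe_nndist, NNReal.dist_eq]
    simp
  rw [this, hT.add, ← map_sub, norm_sub_rev _ f]
  exact hT.norm_le _ _

lemma continuous_of_dense (hd : Dense ((generator T).domain : Set H)) (f : H) :
    Continuous fun t => T t f := by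
  rw [continuous_iff_continuousAt]
  intro t
  rw [ContinuousAt, tendsto_iff_norm_sub_tendsto_zero]
  have h1 : Tendsto (fun s => nndist s t) (𝓝 t) (𝓝 0) := by
    have : Continuous fun s : ℝ≥0 => nndist s t := by fun_prop
    simpa using this.tendsto t
  have h2 := tendsto_iff_norm_sub_tendsto_zero.1 ((hT.tendsto_zero_of_dense hd f).comp h1)
  exact squeeze_zero (fun _ => norm_nonneg _) (fun s => hT.norm_sub_le s t f) h2

/-- Joint continuity in time and vector, needed for the backward derivative, where the operator and
the difference quotient it acts on vary together. -/
lemma tendsto_apply (hd : Dense ((generator T).domain : Set H)) {ι : Type*} {l : Filter ι}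
    {r : ι → ℝ≥0} {v : ι → H} {r₀ : ℝ≥0} {v₀ : H} (hr : Tendsto r l (𝓝 r₀))
    (hv : Tendsto v l (𝓝 v₀)) : Tendsto (fun i => T (r i) (v i)) l (𝓝 (T r₀ v₀)) := by
  have h1 : Tendsto (fun i => T (r i) (v i - v₀)) l (𝓝 0) := by
    rw [tendsto_zero_iff_norm_tendsto_zero]
    exact squeeze_zero (fun _ => norm_nonneg _) (fun i => hT.norm_le _ _)
      (tendsto_iff_norm_sub_tendsto_zero.1 hv)
  have h2 := h1.add (((hT.continuous_of_dense hd v₀).tendsto r₀).comp hr)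
  rw [zero_add] at h2
  refine h2.congr fun i => ?_
  simp

lemma hasGeneratorAt_apply {f g : H} (h : HasGeneratorAt T f g) (s : ℝ≥0) :
    HasGeneratorAt T (T s f) (T s g) := by
  refine (((T s).continuous.tendsto g).comp h).congr fun t => ?_
  rw [Function.comp_apply, map_smul, map_sub, hT.comm]

lemma hasDerivWithinAt_forward {f g : H} (h : HasGeneratorAt T f g) {s : ℝ} (hs : 0 ≤ s) :
    HasDerivWithinAt (fun y : ℝ => T y.toNNReal f) (T s.toNNReal g) (Set.Ici s) s := by
  rw [hasDerivWithinAt_iff_tendsto_slope, Set.Ici_sdiff_left]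
  refine (((T s.toNNReal).continuous.tendsto g).comp
    (h.comp (tendsto_toNNReal_sub s))).congr' ?_
  filter_upwards [self_mem_nhdsWithin] with y hy
  have hy' : 0 < y - s := sub_pos.2 hy
  have : y.toNNReal = s.toNNReal + (y - s).toNNReal := by
    rw [← Real.toNNReal_add hs hy'.le, add_sub_cancel]
  rw [slope_def_module, this, hT.add, Function.comp_apply, Function.comp_apply, map_smul, map_sub,
    Real.coe_toNNReal _ hy'.le, ← Complex.ofReal_inv, Complex.coe_smul]

lemma hasDerivWithinAt_backward (hd : Dense ((generator T).domain : Set H)) {f g : H}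
    (h : HasGeneratorAt T f g) {s t : ℝ} (hst : s < t) :
    HasDerivWithinAt (fun y : ℝ => T (t - y).toNNReal f) (-T (t - s).toNNReal g)
      (Set.Ici s) s := by
  rw [hasDerivWithinAt_iff_tendsto_slope, Set.Ici_sdiff_left]
  have h1 : Tendsto (fun y : ℝ => (t - y).toNNReal) (𝓝[>] s) (𝓝 (t - s).toNNReal) := by
    have : Continuous fun y : ℝ => (t - y).toNNReal := by fun_prop
    exact (this.tendsto s).mono_left nhdsWithin_le_nhds
  refine (hT.tendsto_apply hd h1 (h.comp (tendsto_toNNReal_sub s))).neg.congr' ?_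
  filter_upwards [self_mem_nhdsWithin, Ioo_mem_nhdsGT hst] with y hy hy2
  have hy' : 0 < y - s := sub_pos.2 hy
  have : (t - s).toNNReal = (t - y).toNNReal + (y - s).toNNReal := by
    rw [← Real.toNNReal_add (sub_nonneg.2 hy2.2.le) hy'.le]
    congr 1
    ring
  rw [slope_def_module, this, hT.add, Function.comp_apply, map_smul, map_sub,
    Real.coe_toNNReal _ hy'.le, ← Complex.ofReal_inv, Complex.coe_smul, ← smul_neg, neg_sub]

end IsContractionSemigroup

end Normed

/-! ### Symmetry of the semigroup -/

namespace IsContractionSemigroup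

variable [InnerProductSpace ℂ H] {T : ℝ≥0 → H →L[ℂ] H} (hT : IsContractionSemigroup T)
include hT

/-- A contraction semigroup whose generator is self-adjoint consists of symmetric operators. -/
theorem inner_apply_comm [CompleteSpace H] (hA : IsSelfAdjoint (generator T)) (t : ℝ≥0)
    (f g : H) : inner ℂ (T t f) g = inner ℂ f (T t g) := by
  have hd := hA.dense_domain
  have hsymm : ∀ {f f' g g' : H}, HasGeneratorAt T f f' → HasGeneratorAt T g g' →
      inner ℂ f' g = inner ℂ f g' := by
    intro f f' g g' hf hg
    have h := LinearPMap.adjoint_isFormalAdjoint (T := generator T) hd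
    rw [LinearPMap.isSelfAdjoint_def.1 hA] at h
    have := h ⟨f, f', hf⟩ ⟨g, g', hg⟩
    rwa [hf.generator_eq, hg.generator_eq] at this
  have key : ∀ f ∈ (generator T).domain, ∀ g ∈ (generator T).domain,
      inner ℂ (T t f) g = inner ℂ f (T t g) := by
    rintro f ⟨f', hf⟩ g ⟨g', hg⟩
    have hc : ∀ f, Continuous fun y : ℝ => T y.toNNReal f := fun f =>
      (hT.continuous_of_dense hd f).comp continuous_real_toNNReal
    have hc' : Continuous fun y : ℝ => T ((t : ℝ) - y).toNNReal g :=
      (hc g).comp (continuous_const.sub continuous_id)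
    -- The endpoints `y = 0` and `y = t` give the two sides of the claim. The two terms of the
    -- derivative cancel by symmetry of the generator.
    have := constant_of_has_deriv_right_zero
      (f := fun y : ℝ => inner ℂ (T y.toNNReal f) (T ((t : ℝ) - y).toNNReal g))
      (a := 0) (b := t) ((hc f).inner hc').continuousOn (by
        intro s hs
        have := (hT.hasDerivWithinAt_forward hf hs.1).inner ℂ
          (hT.hasDerivWithinAt_backward hd hg hs.2)
        rw [hsymm (hT.hasGeneratorAt_apply hf _) (hT.hasGeneratorAt_apply hg _),
          inner_neg_right, neg_add_cancel] at this
        exact this) t ⟨t.2, le_rfl⟩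
    simpa [hT.zero] using this
  have h2 : ∀ f ∈ (generator T).domain, ∀ g, inner ℂ (T t f) g = inner ℂ f (T t g) := by
    intro f hf g
    refine hd.induction (fun g hg => key f hf g hg) ?_ g
    exact isClosed_eq (by fun_prop) (by fun_prop)
  refine hd.induction (fun f hf => h2 f hf g) ?_ f
  exact isClosed_eq (by fun_prop) (by fun_prop)

end IsContractionSemigroup

/-! ### Log-convexity and decay with constant one -/

/-- Log-convexity makes the ratios `a (n + 1) / a n` nondecreasing, so each is at least the first
one. Everything is cross-multiplied because terms may vanish. -/
lemma pow_succ_le_of_sq_le {a : ℕ → ℝ} (ha : ∀ n, 0 ≤ a n)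
    (h : ∀ n, a (n + 1) ^ 2 ≤ a n * a (n + 2)) (m : ℕ) : a 1 ^ (m + 1) ≤ a 0 ^ m * a (m + 1) := by
  have h1 : ∀ m, a 1 * a m ≤ a 0 * a (m + 1) := by
    intro m
    induction m with
    | zero => rw [mul_comm]
    | succ m ih =>
      rcases (ha m).eq_or_lt with h0 | h0
      · have : a (m + 1) = 0 := by
          have := h m
          rw [← h0, zero_mul] at this
          exact pow_eq_zero_iff two_ne_zero |>.1 (le_antisymm this (sq_nonneg _))
        rw [this, mul_zero]
        exact mul_nonneg (ha _) (ha _)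
      · refine le_of_mul_le_mul_left ?_ h0
        calc a m * (a 1 * a (m + 1)) = a 1 * a m * a (m + 1) := by ring
          _ ≤ a 0 * a (m + 1) * a (m + 1) := mul_le_mul_of_nonneg_right ih (ha _)
          _ = a 0 * a (m + 1) ^ 2 := by ring
          _ ≤ a 0 * (a m * a (m + 2)) := mul_le_mul_of_nonneg_left (h m) (ha _)
          _ = a m * (a 0 * a (m + 1 + 1)) := by ring
  induction m with
  | zero => simp
  | succ m ih =>
    calc a 1 ^ (m + 1 + 1) = a 1 * a 1 ^ (m + 1) := by ring
      _ ≤ a 1 * (a 0 ^ m * a (m + 1)) := mul_le_mul_of_nonneg_left ih (ha _)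
      _ = a 0 ^ m * (a 1 * a (m + 1)) := by ring
      _ ≤ a 0 ^ m * (a 0 * a (m + 1 + 1)) :=
        mul_le_mul_of_nonneg_left (h1 _) (pow_nonneg (ha _) _)
      _ = a 0 ^ (m + 1) * a (m + 1 + 1) := by ring

lemma le_one_of_frequently_pow_le {x K : ℝ} (h : ∃ᶠ m : ℕ in atTop, x ^ m ≤ K) : x ≤ 1 := by
  by_contra! hx
  refine h ?_
  filter_upwards [(tendsto_pow_atTop_atTop_of_one_lt hx).eventually_gt_atTop K] with m hm
  exact not_le.2 hm

namespace IsContractionSemigroup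

variable [InnerProductSpace ℂ H] {T : ℝ≥0 → H →L[ℂ] H} (hT : IsContractionSemigroup T)
include hT

/-- The sequence `n ↦ ‖T (n s) f‖` is log-convex: moving one factor `T s` across the inner product
gives `‖T ((n+1)s) f‖² = ⟨T (ns) f, T ((n+2)s) f⟩`, and Cauchy-Schwarz applies. -/
lemma norm_apply_pow_le (hs : ∀ t f g, inner ℂ (T t f) g = inner ℂ f (T t g)) (s : ℝ≥0) (f : H)
    (m : ℕ) : ‖T s f‖ ^ (m + 1) ≤ ‖f‖ ^ m * ‖T ((m + 1 : ℕ) * s) f‖ := by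
  have := pow_succ_le_of_sq_le (a := fun n : ℕ => ‖T (n * s) f‖) (fun _ => norm_nonneg _) (by
    intro n
    have h1 : T ((n + 1 : ℕ) * s) f = T s (T (n * s) f) := by
      rw [← hT.add]
      congr 2
      push_cast
      ring
    have h2 : T ((n + 2 : ℕ) * s) f = T s (T ((n + 1 : ℕ) * s) f) := by
      rw [← hT.add]
      congr 2
      push_cast
      ring
    rw [← Complex.ofReal_re (‖T ((n + 1 : ℕ) * s) f‖ ^ 2), Complex.ofReal_pow,
      ← RCLike.ofReal_eq_complex_ofReal, ← inner_self_eq_norm_sq_to_K (𝕜 := ℂ)]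
    conv_lhs => rw [h1, hs, ← h1, ← h2]
    exact (Complex.re_le_norm _).trans (norm_inner_le_norm _ _)) m
  simpa [hT.zero] using this

/-- Exponential decay of an orbit along a sequence of times tending to infinity gives exponential
decay at all times, with constant one, when the operators are symmetric. -/
theorem norm_apply_le_exp (hs : ∀ t f g, inner ℂ (T t f) g = inner ℂ f (T t g)) {f : H}
    {α K : ℝ} (hα : 0 ≤ α) {u : ℕ → ℝ≥0} (hu : Tendsto u atTop atTop)
    (hK : ∀ n, ‖T (u n) f‖ ≤ K * Real.exp (-α * u n)) (t : ℝ≥0) :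
    ‖T t f‖ ≤ Real.exp (-α * t) * ‖f‖ := by
  rcases eq_or_ne t 0 with rfl | ht
  · simp [hT.zero]
  rcases (norm_nonneg f).eq_or_lt with hf | hf
  · rw [← hf, mul_zero, hf]
    exact hT.norm_le _ _
  have ht0 : 0 < t := pos_iff_ne_zero.2 ht
  have hK0 : 0 ≤ K := nonneg_of_mul_nonneg_left ((norm_nonneg _).trans (hK 0)) (Real.exp_pos _)
  suffices h : Real.exp (α * t) * ‖T t f‖ / ‖f‖ ≤ 1 by
    rw [div_le_one hf] at h
    rw [neg_mul, Real.exp_neg, inv_mul_eq_div, le_div_iff₀' (Real.exp_pos _)]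
    exact h
  refine le_one_of_frequently_pow_le (K := K * Real.exp (α * t) / ‖f‖) ?_
  -- The first multiple of `t` beyond `u n`. It overshoots by at most `t`, which costs the factor
  -- `exp (α * t)` in the constant, uniformly in `n`.
  have h1 : Tendsto (fun n => ⌊u n / t⌋₊ + 1) atTop atTop := by
    refine tendsto_add_atTop_nat 1 |>.comp (tendsto_nat_floor_atTop.comp ?_)
    exact hu.atTop_div_const ht0
  refine h1.frequently (Frequently.of_forall fun n => ?_)
  set m := ⌊u n / t⌋₊ with hm
  have h2 : u n ≤ (m + 1 : ℕ) * t := by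
    have := (Nat.lt_floor_add_one (u n / t)).le
    rw [div_le_iff₀ ht0] at this
    exact_mod_cast this
  have h3 : (m : ℝ) * t ≤ u n := by
    have := Nat.floor_le (zero_le (a := u n / t))
    rw [le_div_iff₀ ht0] at this
    exact_mod_cast this
  have h4 : ‖T t f‖ ^ (m + 1) ≤ ‖f‖ ^ m * (K * Real.exp (-α * (m * t))) := by
    refine (hT.norm_apply_pow_le hs t f m).trans ?_
    refine mul_le_mul_of_nonneg_left ?_ (by positivity)
    refine (hT.norm_antitone f h2).trans ((hK n).trans ?_)
    refine mul_le_mul_of_nonneg_left (Real.exp_le_exp.2 ?_) hK0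
    nlinarith
  rw [div_pow, mul_pow, ← Real.exp_nat_mul, div_le_div_iff₀ (by positivity) hf]
  calc Real.exp ((m + 1 : ℕ) * (α * t)) * ‖T t f‖ ^ (m + 1) * ‖f‖
      ≤ Real.exp ((m + 1 : ℕ) * (α * t)) * (‖f‖ ^ m * (K * Real.exp (-α * (m * t)))) * ‖f‖ := by
        gcongr
    _ = K * (Real.exp ((m + 1 : ℕ) * (α * t)) * Real.exp (-α * (m * t))) * ‖f‖ ^ (m + 1) := by
        ring
    _ = K * Real.exp (α * t) * ‖f‖ ^ (m + 1) := by
        rw [← Real.exp_add]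
        congr 3
        push_cast
        ring

end IsContractionSemigroup

/-- Exponential decay of `T t (f - e)` for a fixed vector `e` of symmetric operators implies
a bound of the quadratic form of the generator. -/
theorem HasGeneratorAt.norm_sq_le [InnerProductSpace ℂ H] {T : ℝ≥0 → H →L[ℂ] H}
    (hs : ∀ t f g, inner ℂ (T t f) g = inner ℂ f (T t g)) {f g e : H} (he : ∀ t, T t e = e)
    (hg : HasGeneratorAt T f g) {α : ℝ}
    (hdec : ∀ t, ‖T t (f - e)‖ ≤ Real.exp (-α * t) * ‖f - e‖) :
    α * ‖f - e‖ ^ 2 ≤ -(inner ℂ g f).re := by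
  have h1 : Tendsto (fun t : ℝ≥0 => (inner ℂ (((t : ℝ) : ℂ)⁻¹ • (T t f - f)) f).re) (𝓝[>] 0)
      (𝓝 (inner ℂ g f).re) := by
    have : Continuous fun x : H => (inner ℂ x f).re := by fun_prop
    exact (this.tendsto g).comp hg
  have h2 : Tendsto (fun t : ℝ≥0 => (t : ℝ)⁻¹ * (Real.exp (-α * t) - 1) * ‖f - e‖ ^ 2) (𝓝[>] 0)
      (𝓝 (-α * ‖f - e‖ ^ 2)) := by
    refine Tendsto.mul_const _ ?_
    have hd : HasDerivAt (fun y : ℝ => Real.exp (-α * y)) (-α) 0 := by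
      simpa using ((hasDerivAt_id (0 : ℝ)).const_mul (-α)).exp
    have hd' := hasDerivAt_iff_tendsto_slope_zero.1 hd
    have h0 : Tendsto (fun t : ℝ≥0 => (t : ℝ)) (𝓝[>] 0) (𝓝[≠] 0) := by
      refine tendsto_nhdsWithin_iff.2 ⟨?_, ?_⟩
      · have : Continuous fun t : ℝ≥0 => (t : ℝ) := by fun_prop
        simpa using (this.tendsto 0).mono_left nhdsWithin_le_nhds
      · filter_upwards [self_mem_nhdsWithin] with y hy
        have h0 : (0 : ℝ≥0) < y := hy
        simpa using h0.ne'
    refine (hd'.comp h0).congr fun t => ?_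
    simp
  -- The comparison holds for every `t`, including `t = 0`, where the inverse is zero.
  have h3 := le_of_tendsto_of_tendsto' h1 h2 (by
    intro t
    -- Since `e` is fixed and `T t` is symmetric, `f` may be replaced by `f - e` in both slots.
    have e1 : inner ℂ (T t f - f) e = 0 := by
      rw [inner_sub_left, hs, he, sub_self]
    have e2 : T t f - f = T t (f - e) - (f - e) := by rw [map_sub, he]; abel
    have e3 : inner ℂ (T t f - f) f = inner ℂ (T t (f - e) - (f - e)) (f - e) := by
      rw [← e2, inner_sub_right, e1, sub_zero]
    rw [inner_smul_left, e3, map_inv₀, Complex.conj_ofReal, ← Complex.ofReal_inv,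
      Complex.re_ofReal_mul, mul_assoc]
    refine mul_le_mul_of_nonneg_left ?_ (by positivity)
    rw [inner_sub_left, Complex.sub_re, inner_self_eq_norm_sq_to_K, sub_mul, one_mul]
    refine sub_le_sub ?_ (by simp [← Complex.ofReal_pow])
    calc (inner ℂ (T t (f - e)) (f - e)).re ≤ ‖T t (f - e)‖ * ‖f - e‖ :=
          (Complex.re_le_norm _).trans (norm_inner_le_norm _ _)
      _ ≤ Real.exp (-α * t) * ‖f - e‖ * ‖f - e‖ := by gcongr; exact hdec t
      _ = Real.exp (-α * t) * ‖f - e‖ ^ 2 := by ring)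
  linarith

end AbstractSemigroup

end MarkovPoincare

namespace MarkovPoincare

/-! ### Markov operators on real functions, weighted norms and densities -/

section MarkovOperators

variable {X : Type*} [MeasurableSpace X] {μ : Measure X}

lemma coeFn_l2Operator {κ : Kernel X X} [IsMarkovKernel κ] [IsFiniteMeasure μ]
    (hκ : κ.Invariant μ) (f : Lp ℂ 2 μ) :
    l2Operator hκ f =ᵐ[μ] fun x => ∫ y, f y ∂(κ x) :=
  (memLp_average hκ f).coeFn_toLp

lemma norm_l2Operator_le {κ : Kernel X X} [IsMarkovKernel κ] [IsFiniteMeasure μ]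
    (hκ : κ.Invariant μ) (f : Lp ℂ 2 μ) : ‖l2Operator hκ f‖ ≤ ‖f‖ := by
  change ‖(memLp_average hκ f).toLp _‖ ≤ ‖f‖
  rw [Lp.norm_toLp, Lp.norm_def]
  exact ENNReal.toReal_mono (Lp.memLp f).2.ne (eLpNorm_average_le hκ (Lp.stronglyMeasurable f))

theorem isContractionSemigroup_l2Semigroup [IsFiniteMeasure μ] {p : ℝ≥0 → Kernel X X}
    [∀ t, IsMarkovKernel (p t)] (hp : IsTransitionSemigroup p) (hμ : ∀ t, (p t).Invariant μ) :
    IsContractionSemigroup (l2Semigroup p hμ) where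
  zero f := by
    refine Lp.ext ((coeFn_l2Operator (hμ 0) f).trans (Eventually.of_forall fun x => ?_))
    dsimp only
    rw [hp.zero, Kernel.id_apply, integral_dirac' _ _ (Lp.stronglyMeasurable f)]
  add s t f := by
    refine Lp.ext ((coeFn_l2Operator (hμ (s + t)) f).trans ?_)
    refine EventuallyEq.trans ?_ (coeFn_l2Operator (hμ s) _).symm
    filter_upwards [ae_ae_of_invariant (hμ s) (coeFn_l2Operator (hμ t) f),
      ae_integrable (hμ (s + t)) f] with x hx hi
    rw [hp.add] at hi
    change ∫ y, f y ∂(p (s + t) x) = ∫ y, l2Operator (hμ t) f y ∂(p s x)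
    rw [integral_congr_ae hx, hp.add]
    exact Kernel.integral_comp hi
  norm_le t f := norm_l2Operator_le (hμ t) f

/-- The element of the complex space `L²(μ)` given by a real function. -/
noncomputable def toComplexLp {f : X → ℝ} (hf : MemLp f 2 μ) : Lp ℂ 2 μ :=
  (hf.ofReal (K := ℂ)).toLp _

lemma coeFn_toComplexLp {f : X → ℝ} (hf : MemLp f 2 μ) :
    toComplexLp hf =ᵐ[μ] fun x => (f x : ℂ) :=
  (hf.ofReal (K := ℂ)).coeFn_toLp

lemma inner_toComplexLp {f g : X → ℝ} (hf : MemLp f 2 μ) (hg : MemLp g 2 μ) :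
    inner ℂ (toComplexLp hf) (toComplexLp hg) = ((∫ x, f x * g x ∂μ : ℝ) : ℂ) := by
  rw [L2.inner_def, ← integral_complex_ofReal]
  refine integral_congr_ae ?_
  filter_upwards [coeFn_toComplexLp hf, coeFn_toComplexLp hg] with x h1 h2
  rw [h1, h2, RCLike.inner_apply, Complex.conj_ofReal, Complex.ofReal_mul, mul_comm]

lemma norm_toComplexLp_sq {f : X → ℝ} (hf : MemLp f 2 μ) :
    ‖toComplexLp hf‖ ^ 2 = ∫ x, f x ^ 2 ∂μ := by
  have h := inner_self_eq_norm_sq_to_K (𝕜 := ℂ) (toComplexLp hf)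
  rw [inner_toComplexLp] at h
  simp_rw [← pow_two] at h
  exact (Complex.ofReal_injective (h.trans (Complex.ofReal_pow _ 2).symm)).symm

lemma toComplexLp_sub {f g : X → ℝ} (hf : MemLp f 2 μ) (hg : MemLp g 2 μ) :
    toComplexLp (hf.sub hg) = toComplexLp hf - toComplexLp hg := by
  refine Lp.ext ((coeFn_toComplexLp _).trans (EventuallyEq.trans ?_ (Lp.coeFn_sub _ _).symm))
  filter_upwards [coeFn_toComplexLp hf, coeFn_toComplexLp hg] with x h1 h2
  simp [h1, h2]

lemma toComplexLp_const_mul {f : X → ℝ} (hf : MemLp f 2 μ) (c : ℝ) :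
    toComplexLp (hf.const_mul c) = (c : ℂ) • toComplexLp hf := by
  refine Lp.ext ((coeFn_toComplexLp _).trans (EventuallyEq.trans ?_ (Lp.coeFn_smul _ _).symm))
  filter_upwards [coeFn_toComplexLp hf] with x h1
  simp [h1]

lemma variance_eq_norm_sub_sq [IsFiniteMeasure μ] {f : X → ℝ} (hf : MemLp f 2 μ) :
    variance f μ = ‖toComplexLp hf - toComplexLp (memLp_const (∫ x, f x ∂μ))‖ ^ 2 := by
  rw [← toComplexLp_sub, norm_toComplexLp_sq]
  exact variance_eq_integral hf.aestronglyMeasurable.aemeasurable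

lemma l2Operator_toComplexLp {κ : Kernel X X} [IsMarkovKernel κ] [IsFiniteMeasure μ]
    (hκ : κ.Invariant μ) {f : X → ℝ} (hf : MemLp f 2 μ) (hf' : MemLp (average κ f) 2 μ) :
    l2Operator hκ (toComplexLp hf) = toComplexLp hf' := by
  refine Lp.ext ((coeFn_l2Operator hκ _).trans (EventuallyEq.trans ?_ (coeFn_toComplexLp _).symm))
  filter_upwards [ae_ae_of_invariant hκ (coeFn_toComplexLp hf)] with x hx
  rw [integral_congr_ae hx, integral_complex_ofReal, average]

lemma average_const (κ : Kernel X X) [IsMarkovKernel κ] (c : ℝ) :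
    average κ (fun _ => c) = fun _ => c := by
  ext x
  simp [average]

lemma l2Operator_const {κ : Kernel X X} [IsMarkovKernel κ] [IsFiniteMeasure μ]
    (hκ : κ.Invariant μ) (c : ℝ) :
    l2Operator hκ (toComplexLp (memLp_const c)) = toComplexLp (memLp_const c) := by
  have h : MemLp (average κ fun _ => c) 2 μ := by
    rw [average_const]
    exact memLp_const c
  rw [l2Operator_toComplexLp hκ _ h]
  congr 1
  exact average_const κ c

lemma measurable_average (κ : Kernel X X) [IsMarkovKernel κ] {f : X → ℝ} (hf : Measurable f) :
    Measurable (average κ f) :=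
  (hf.stronglyMeasurable.integral_kernel (κ := κ)).measurable

lemma abs_average_le (κ : Kernel X X) [IsMarkovKernel κ] {f : X → ℝ} {M : ℝ}
    (hM : ∀ x, |f x| ≤ M) (x : X) : |average κ f x| ≤ M := by
  have := norm_integral_le_of_norm_le_const (f := f) (μ := κ x) (Eventually.of_forall hM)
  simpa [average] using this

lemma memLp_of_abs_le [IsFiniteMeasure μ] {f : X → ℝ} (hf : Measurable f) {M : ℝ}
    (hM : ∀ x, |f x| ≤ M) {q : ℝ≥0∞} : MemLp f q μ :=
  MemLp.of_bound hf.aestronglyMeasurable M (Eventually.of_forall hM)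

lemma integrable_of_abs_le [IsFiniteMeasure μ] {f : X → ℝ} (hf : Measurable f) {M : ℝ}
    (hM : ∀ x, |f x| ≤ M) : Integrable f μ :=
  Integrable.of_bound hf.aestronglyMeasurable M (Eventually.of_forall hM)

/-- The Hölder inequality for integrals against a difference of measures, for the total variation
measure. -/
lemma integral_sub_integral_le_totalVariation (m₁ m₂ : Measure X) [IsFiniteMeasure m₁]
    [IsFiniteMeasure m₂] {u : X → ℝ} (hu : Measurable u) {M : ℝ} (hM : ∀ x, |u x| ≤ M) :
    ∫ x, u x ∂m₁ - ∫ x, u x ∂m₂ ≤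
      ∫ x, |u x| ∂(m₁.toSignedMeasure - m₂.toSignedMeasure).totalVariation := by
  set σ := m₁.toSignedMeasure - m₂.toSignedMeasure with hσ
  set a := σ.toJordanDecomposition.posPart with ha
  set b := σ.toJordanDecomposition.negPart with hb
  have hi : ∀ (m : Measure X) [IsFiniteMeasure m], Integrable u m :=
    fun m _ => integrable_of_abs_le hu hM
  -- The Jordan identity `m₁ - m₂ = a - b`, rearranged so that it holds between positive measures
  -- and can be integrated.
  have h1 : m₁ + b = m₂ + a := by
    rw [← Measure.toSignedMeasure_eq_toSignedMeasure_iff, Measure.toSignedMeasure_add,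
      Measure.toSignedMeasure_add]
    have h : a.toSignedMeasure - b.toSignedMeasure = σ :=
      σ.toSignedMeasure_toJordanDecomposition
    have h' := h.trans hσ
    rw [sub_eq_sub_iff_add_eq_add] at h'
    rw [add_comm m₂.toSignedMeasure, h']
  have h2 : ∫ x, u x ∂m₁ + ∫ x, u x ∂b = ∫ x, u x ∂m₂ + ∫ x, u x ∂a := by
    rw [← integral_add_measure (hi _) (hi _), ← integral_add_measure (hi _) (hi _), h1]
  have h3 : ∫ x, |u x| ∂σ.totalVariation = ∫ x, |u x| ∂a + ∫ x, |u x| ∂b := by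
    rw [SignedMeasure.totalVariation, integral_add_measure (hi _).abs (hi _).abs]
  have h4 : ∫ x, u x ∂a ≤ ∫ x, |u x| ∂a := integral_mono (hi _) (hi _).abs fun x => le_abs_self _
  have h5 := neg_le_of_abs_le (abs_integral_le_integral_abs (f := u) (μ := b))
  linarith

lemma integral_abs_totalVariation_le {W u : X → ℝ} (hW1 : ∀ x, 1 ≤ W x) (hu : Measurable u)
    (π : SignedMeasure X) {a b : ℝ} (ha : 0 ≤ a) (hb : 0 ≤ b)
    (h1 : weightedSupNorm W u ≤ ENNReal.ofReal a) (h2 : weightedTV W π ≤ ENNReal.ofReal b) :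
    ∫ x, |u x| ∂π.totalVariation ≤ a * b := by
  rw [integral_eq_lintegral_of_nonneg_ae (Eventually.of_forall fun x => abs_nonneg _)
    hu.norm.aestronglyMeasurable]
  refine ENNReal.toReal_le_of_le_ofReal (mul_nonneg ha hb) ?_
  rw [ENNReal.ofReal_mul ha]
  calc ∫⁻ x, ENNReal.ofReal |u x| ∂π.totalVariation
      ≤ ∫⁻ x, ENNReal.ofReal a * ENNReal.ofReal (W x) ∂π.totalVariation := by
        refine lintegral_mono fun x => ?_
        have hx : 0 < W x := zero_lt_one.trans_le (hW1 x)
        have h3 := (le_iSup (fun x => ENNReal.ofReal (|u x| / W x)) x).trans h1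
        rw [ENNReal.ofReal_le_ofReal_iff ha, div_le_iff₀ hx] at h3
        rw [← ENNReal.ofReal_mul ha]
        exact ENNReal.ofReal_le_ofReal h3
    _ = ENNReal.ofReal a * weightedTV W π := lintegral_const_mul' _ _ ENNReal.ofReal_ne_top
    _ ≤ ENNReal.ofReal a * ENNReal.ofReal b := by gcongr

namespace BoundedDensity

variable (h : BoundedDensity μ)

lemma exists_abs_le : ∃ M, ∀ x, |h.toFun x| ≤ M := by
  obtain ⟨M, hM⟩ := h.bounded
  exact ⟨M, fun x => by rw [abs_of_nonneg (h.nonneg x)]; exact hM x⟩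

lemma memLp [IsFiniteMeasure μ] : MemLp h.toFun 2 μ := by
  obtain ⟨M, hM⟩ := h.exists_abs_le
  exact memLp_of_abs_le h.measurable hM

lemma integral_comp_measure (κ : Kernel X X) [IsMarkovKernel κ] {u : X → ℝ} (hu : Measurable u)
    {M : ℝ} (hM : ∀ x, |u x| ≤ M) :
    ∫ x, u x ∂(κ ∘ₘ h.measure) = ∫ x, h.toFun x * average κ u x ∂μ := by
  have hi : Integrable u ((κ ∘ₖ Kernel.const Unit h.measure) ()) := integrable_of_abs_le hu hM
  rw [Measure.comp_eq_comp_const_apply, Kernel.integral_comp hi, Kernel.const_apply, measure,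
    integral_withDensity_eq_integral_toReal_smul h.measurable.ennreal_ofReal
      (Eventually.of_forall fun _ => ENNReal.ofReal_lt_top)]
  refine integral_congr_ae (Eventually.of_forall fun x => ?_)
  simp [ENNReal.toReal_ofReal (h.nonneg x), average]

/-- The squared `L²` distance of `𝒫[h]` from `1`, for a symmetric Markov operator, is bounded by
the product of the weighted distances of the density and of the measure from equilibrium. -/
theorem norm_l2Operator_sub_sq_le [IsProbabilityMeasure μ] {κ : Kernel X X} [IsMarkovKernel κ]
    (hκ : κ.Invariant μ)
    (hs : ∀ f g, inner ℂ (l2Operator hκ f) g = inner ℂ f (l2Operator hκ g))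
    {W : X → ℝ} (hW1 : ∀ x, 1 ≤ W x) {a b : ℝ} (ha : 0 ≤ a) (hb : 0 ≤ b)
    (h1 : weightedSupNorm W (fun x => average κ h.toFun x - 1) ≤ ENNReal.ofReal a)
    (h2 : weightedTV W ((κ ∘ₘ h.measure).toSignedMeasure - μ.toSignedMeasure) ≤
      ENNReal.ofReal b) :
    ‖l2Operator hκ (toComplexLp h.memLp - toComplexLp (memLp_const 1))‖ ^ 2 ≤ a * b := by
  obtain ⟨M, hM⟩ := h.exists_abs_le
  have hFm := measurable_average κ h.measurable
  have hF : MemLp (average κ h.toFun) 2 μ := memLp_of_abs_le hFm (abs_average_le κ hM)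
  set u : X → ℝ := fun x => average κ h.toFun x - 1 with hu
  have hum : Measurable u := hFm.sub_const 1
  have huM : ∀ x, |u x| ≤ M + 1 := fun x =>
    (abs_sub _ _).trans (by rw [abs_one]; gcongr; exact abs_average_le κ hM x)
  have hu2 : MemLp u 2 μ := memLp_of_abs_le hum huM
  have hui : Integrable u μ := integrable_of_abs_le hum huM
  have hu2' : MemLp (average κ u) 2 μ :=
    memLp_of_abs_le (measurable_average κ hum) (abs_average_le κ huM)
  have e1 : l2Operator hκ (toComplexLp h.memLp - toComplexLp (memLp_const 1)) =
      toComplexLp hu2 := by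
    rw [map_sub, l2Operator_const, l2Operator_toComplexLp hκ _ hF, ← toComplexLp_sub]
  have e2 : ∫ x, h.toFun x * average κ u x ∂μ = ∫ x, average κ h.toFun x * u x ∂μ := by
    have := hs (toComplexLp h.memLp) (toComplexLp hu2)
    rw [l2Operator_toComplexLp hκ _ hF, l2Operator_toComplexLp hκ _ hu2', inner_toComplexLp,
      inner_toComplexLp] at this
    exact_mod_cast this.symm
  -- Expand `u² = (𝒫h) u - u`; by symmetry the first term integrates to `∫ h 𝒫u dμ`, the integral of
  -- `u` against the evolved measure.
  have e3 : ∫ x, u x ^ 2 ∂μ = ∫ x, u x ∂(κ ∘ₘ h.measure) - ∫ x, u x ∂μ := by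
    have hFu : Integrable (fun x => average κ h.toFun x * u x) μ := hF.integrable_mul hu2
    rw [h.integral_comp_measure κ hum huM, e2, ← integral_sub hFu hui]
    refine integral_congr_ae (Eventually.of_forall fun x => ?_)
    simp only [hu]
    ring
  rw [e1, norm_toComplexLp_sq, e3]
  exact (integral_sub_integral_le_totalVariation _ _ hum huM).trans
    (integral_abs_totalVariation_le hW1 hum _ ha hb h1 h2)

end BoundedDensity

/-- A bounded centered function is a multiple of `h - 1` for a bounded density `h`. -/
lemma exists_boundedDensity [IsProbabilityMeasure μ] {f : X → ℝ} (hf : Measurable f) {M : ℝ}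
    (hM : ∀ x, |f x| ≤ M) :
    ∃ (h : BoundedDensity μ) (c : ℝ), ∀ x, f x - ∫ y, f y ∂μ = c * (h.toFun x - 1) := by
  set m := ∫ y, f y ∂μ with hm
  have hi : Integrable f μ := integrable_of_abs_le hf hM
  have hM' : ∀ x, |f x - m| ≤ |M| + |m| + 1 := fun x =>
    (abs_sub _ _).trans (by linarith [hM x, le_abs_self M])
  -- The summand `1` keeps `c` positive; `|f - m| ≤ c` keeps `1 + (f - m) / c` between `0` and `2`.
  set c := |M| + |m| + 1 with hc
  have hc0 : 0 < c := by positivity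
  refine ⟨⟨fun x => 1 + (f x - m) / c, by fun_prop, fun x => ?_, ⟨2, fun x => ?_⟩, ?_⟩, c,
    fun x => ?_⟩
  · have := (le_div_iff₀ hc0).2 (show -1 * c ≤ f x - m by linarith [neg_le_of_abs_le (hM' x)])
    linarith
  · have := (div_le_one hc0).2 ((le_abs_self _).trans (hM' x))
    linarith
  · have hi' : Integrable (fun x => (f x - m) / c) μ := (hi.sub (integrable_const _)).div_const _
    rw [integral_add (integrable_const _) hi',
      integral_div, integral_sub hi (integrable_const _)]
    simp [← hm]
  · dsimp only
    rw [add_sub_cancel_left, mul_div_cancel₀ _ hc0.ne']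

/-- Estimates for centered bounded real functions extend to centered real functions in `L²`. -/
lemma centered_norm_le_of_bounded [IsProbabilityMeasure μ] (S : Lp ℂ 2 μ →L[ℂ] Lp ℂ 2 μ) (r : ℝ)
    (hS : ∀ (f : X → ℝ) (hf : MemLp f 2 μ), Measurable f → (∃ M, ∀ x, |f x| ≤ M) →
      ‖S (toComplexLp hf - toComplexLp (memLp_const (∫ x, f x ∂μ)))‖ ≤
        r * ‖toComplexLp hf - toComplexLp (memLp_const (∫ x, f x ∂μ))‖)
    {f : X → ℝ} (hf : MemLp f 2 μ) :
    ‖S (toComplexLp hf - toComplexLp (memLp_const (∫ x, f x ∂μ)))‖ ≤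
      r * ‖toComplexLp hf - toComplexLp (memLp_const (∫ x, f x ∂μ))‖ := by
  set e : Lp ℂ 2 μ := toComplexLp (memLp_const (1 : ℝ)) with he
  -- Centering written as the projection off the constants, hence continuous in `g`.
  let Q : Lp ℂ 2 μ → Lp ℂ 2 μ := fun g => g - inner ℂ e g • e
  have hQc : Continuous Q := by fun_prop
  have hQ : ∀ (f : X → ℝ) (hf : MemLp f 2 μ),
      toComplexLp hf - toComplexLp (memLp_const (∫ x, f x ∂μ)) = Q (toComplexLp hf) := by
    intro f hf
    simp only [Q]
    rw [he, inner_toComplexLp, ← toComplexLp_const_mul]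
    simp
  -- The estimate is available only for real functions, so the density of simple functions is used
  -- in real `L²` and transported by this continuous embedding.
  let J := Complex.ofRealCLM.compLpL 2 μ
  have hJ : ∀ (g : Lp ℝ 2 μ) (f : X → ℝ) (hf : MemLp f 2 μ), g =ᵐ[μ] f → J g = toComplexLp hf := by
    intro g f hf hgf
    refine Lp.ext ((Complex.ofRealCLM.coeFn_compLpL g).trans
      (EventuallyEq.trans ?_ (coeFn_toComplexLp hf).symm))
    filter_upwards [hgf] with x hx
    simp [hx]
  have key : ∀ g : Lp ℝ 2 μ, ‖S (Q (J g))‖ ≤ r * ‖Q (J g)‖ := by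
    intro g
    refine (Lp.simpleFunc.denseRange (E := ℝ) (μ := μ) (p := 2) (by norm_num)).induction_on g
      (isClosed_le (by fun_prop) (by fun_prop)) fun s => ?_
    have hm := Lp.simpleFunc.memLp s
    rw [hJ _ _ hm (Lp.simpleFunc.toSimpleFunc_eq_toFun s).symm, ← hQ]
    exact hS _ hm (Lp.simpleFunc.toSimpleFunc s).measurable
      (Lp.simpleFunc.toSimpleFunc s).exists_forall_norm_le
  rw [hQ, ← hJ _ f hf hf.coeFn_toLp]
  exact key _

end MarkovOperators

end MarkovPoincare

/-! ### The Poincaré inequality -/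

theorem mainTheorem9 {X : Type*} [MeasurableSpace X]
    (p : ℝ≥0 → Kernel X X) [∀ t, IsMarkovKernel (p t)]
    (hp : MarkovPoincare.IsTransitionSemigroup p)
    (μ : Measure X) [IsProbabilityMeasure μ] (hμ : ∀ t, (p t).Invariant μ)
    (hA : IsSelfAdjoint (MarkovPoincare.generator (MarkovPoincare.l2Semigroup p hμ)))
    (W : X → ℝ) (hW : Measurable W) (hW1 : ∀ x, 1 ≤ W x)
    (lam rho : ℝ) (hlam : 0 ≤ lam) (hrho : 0 ≤ rho) (hne : lam ≠ 0 ∨ rho ≠ 0)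
    (hconv : ∀ h : MarkovPoincare.BoundedDensity μ,
      ∃ (t : ℕ → ℝ≥0) (C D : ℝ≥0), Tendsto t atTop atTop ∧ ∀ n,
        MarkovPoincare.weightedSupNorm W (fun x => MarkovPoincare.average (p (t n)) h.toFun x - 1)
            ≤ ENNReal.ofReal (D * Real.exp (-rho * t n)) ∧
        MarkovPoincare.weightedTV W
            ((p (t n) ∘ₘ h.measure).toSignedMeasure - μ.toSignedMeasure)
            ≤ ENNReal.ofReal (C * Real.exp (-lam * t n))) :
    MarkovPoincare.PoincareInequality
      (MarkovPoincare.generator (MarkovPoincare.l2Semigroup p hμ)) (2 / (lam + rho)) := by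
  have hT := MarkovPoincare.isContractionSemigroup_l2Semigroup hp hμ
  have hs := hT.inner_apply_comm hA
  have hpos : 0 < lam + rho := by
    rcases hne with h | h
    · exact add_pos_of_pos_of_nonneg (hlam.lt_of_ne' h) hrho
    · exact add_pos_of_nonneg_of_pos hlam (hrho.lt_of_ne' h)
  set α := (lam + rho) / 2 with hα
  have hα0 : 0 < α := by positivity
  have hdens : ∀ (h : MarkovPoincare.BoundedDensity μ) (t : ℝ≥0),
      ‖MarkovPoincare.l2Semigroup p hμ t (MarkovPoincare.toComplexLp h.memLp -
        MarkovPoincare.toComplexLp (memLp_const 1))‖ ≤ Real.exp (-α * t) *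
          ‖MarkovPoincare.toComplexLp h.memLp - MarkovPoincare.toComplexLp (memLp_const 1)‖ := by
    intro h t
    obtain ⟨u, C, D, hu, hCD⟩ := hconv h
    -- The squared norm is bounded by `D e^{-rho u} * C e^{-lam u}`; its square root gives this `K`
    -- and the rate `α`.
    refine hT.norm_apply_le_exp hs (K := √(D * C)) hα0.le hu (fun n => ?_) t
    have := h.norm_l2Operator_sub_sq_le (hμ (u n)) (hs (u n)) hW1 (by positivity) (by positivity)
      (hCD n).1 (hCD n).2
    refine le_of_sq_le_sq (this.trans_eq ?_) (by positivity)
    rw [mul_pow, Real.sq_sqrt (by positivity), ← Real.exp_nat_mul, mul_mul_mul_comm,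
      ← Real.exp_add]
    congr 2
    rw [hα]
    push_cast
    ring
  have hdec : ∀ (f : X → ℝ) (hf : MemLp f 2 μ) (t : ℝ≥0),
      ‖MarkovPoincare.l2Semigroup p hμ t (MarkovPoincare.toComplexLp hf -
        MarkovPoincare.toComplexLp (memLp_const (∫ x, f x ∂μ)))‖ ≤ Real.exp (-α * t) *
          ‖MarkovPoincare.toComplexLp hf -
            MarkovPoincare.toComplexLp (memLp_const (∫ x, f x ∂μ))‖ := by
    intro f hf t
    refine MarkovPoincare.centered_norm_le_of_bounded _ _ (fun f hf hfm hM => ?_) hf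
    obtain ⟨M, hM⟩ := hM
    obtain ⟨h, c, hc⟩ := MarkovPoincare.exists_boundedDensity (μ := μ) hfm hM
    have heq : MarkovPoincare.toComplexLp hf -
        MarkovPoincare.toComplexLp (memLp_const (∫ x, f x ∂μ)) = (c : ℂ) •
          (MarkovPoincare.toComplexLp h.memLp - MarkovPoincare.toComplexLp (memLp_const 1)) := by
      rw [← MarkovPoincare.toComplexLp_sub, ← MarkovPoincare.toComplexLp_sub,
        ← MarkovPoincare.toComplexLp_const_mul]
      congr 1
      exact funext hc
    rw [heq, map_smul, norm_smul, norm_smul, mul_left_comm]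
    exact mul_le_mul_of_nonneg_left (hdens h t) (norm_nonneg _)
  intro g hg
  have hf : MemLp (fun x => ((g : Lp ℂ 2 μ) x).re) 2 μ := (Lp.memLp (g : Lp ℂ 2 μ)).re
  have hgf : (g : Lp ℂ 2 μ) = MarkovPoincare.toComplexLp hf := by
    refine Lp.ext (EventuallyEq.trans ?_ (MarkovPoincare.coeFn_toComplexLp hf).symm)
    filter_upwards [hg] with x hx
    exact Complex.ext rfl hx
  have hvar : variance (fun x => ((g : Lp ℂ 2 μ) x).re) μ =
      ‖(g : Lp ℂ 2 μ) - MarkovPoincare.toComplexLp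
        (memLp_const (∫ x, ((g : Lp ℂ 2 μ) x).re ∂μ))‖ ^ 2 := by
    rw [MarkovPoincare.variance_eq_norm_sub_sq hf, ← hgf]
  have hmain := (MarkovPoincare.hasGeneratorAt_generator g).norm_sq_le hs
    (fun t => MarkovPoincare.l2Operator_const (hμ t) (∫ x, ((g : Lp ℂ 2 μ) x).re ∂μ)) (α := α)
    (fun t => by
      have := hdec _ hf t
      rwa [← hgf] at this)
  rw [← hvar] at hmain
  have hinv : 2 / (lam + rho) = α⁻¹ := by rw [hα, inv_div]
  rw [hinv, neg_mul, ← mul_neg, ← div_eq_inv_mul, le_div_iff₀' hα0]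
  exact hmain
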